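/- Let $M$ be a smooth $m$-dimensional manifold without boundary (Hausdorff and second countable, not necessarily compact), and let $\phi:\mathbb R\times M\to M$ be a smooth flow, i.e. $\phi$ is smooth, $\phi(0,x)=x$ and $\phi(t,\phi(s,x))=\phi(t+s,x)$ for all $s,t\in\mathbb R$, $x\in M$. For $N\subset M$ put $\mathrm{Inv}(N,\phi)=\{x\in N:\phi(t,x)\in N\ \forall t\in\mathbb R\}$. A compact set $N\subset M$ is an isolating neighborhood if $\mathrm{Inv}(N,\phi)\subset\mathrm{int}(N)$; it is an isolating neighborhood for $S$ if moreover $\mathrm{Inv}(N,\phi)=S$. A set $S\subset M$ is an isolated invariant set if $\phi(t,S)=S$ for all $t\in\mathbb R$ and $S$ has an isolating neighborhood. An isolating neighborhood $B\subset M$ is a smooth isolating block if $B$ is a compact $m$-dimensional submanifold of $M$ with piecewise smooth boundary $\partial B$ (locally a topological half-space at boundary points, with $\partial B$ covered by finitely many smooth hypersurfaces) such that (i) $\partial B=B_+\cup B_-\cup B_\pm$ with $B_+\cap B_-=B_\pm$, and $B_-\setminus B_\pm$, $B_+\setminus B_\pm$ are (possibly empty) smooth $(m-1)$-dimensional submanifolds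 of $M$; (ii) there are smooth $(m-1)$-dimensional submanifolds without boundary $D_-,D_+$ of $M$ with $B_+\subset D_+$, $B_-\subset D_-$, such that $D_-\cap D_+=B_\pm$ is a (possibly empty) $(m-2)$-dimensional smooth submanifold; (iii) the flow is transverse to $D_-$ and $D_+$, and for every $x\in D_-$ (respectively $x\in D_+$) there is $\epsilon>0$ such that $\phi(t,x)\notin B$ for all $t\in(0,\epsilon)$ (respectively all $t\in(-\epsilon,0)$). A smooth function $f:M\to\mathbb R$ has the Lyapunov property for $S$ with respect to a set $N$ if $\frac{d}{dt}\big|_{t=0}f(\phi(t,x))<0$ for all $x\in N\setminus S$. It is a smooth Lyapunov function for $S$ if it is constant on $S$ and has the Lyapunov property with respect to some isolating neighborhood $N$ for $S$. Proposition. Let $S\subset M$ be an isolated invariant set for $\phi$ and let $B\subset M$ be a smooth isolating block with $\mathrm{Inv}(B,\phi)=S$. Then there exists a smooth Lyapunov function $f_\phi:M\to\mathbb R$ for $S$ which has the Lyapunov property with respect to $B$; that is, $f_\phi$ is smooth and constant on $S$, and $\frac{d}{dt}\big|_{t=0}f_\phi(\phi(t,x))<0$ for all $x\in B\setminus S$.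 -/

import Mathlib

open scoped Manifold ContDiff
open Set

namespace IsolatedDynamics

section Flows

variable {M : Type*} [TopologicalSpace M]

/-- The maximal invariant set of the flow `φ` in `N`. -/
def maxInv (φ : Flow ℝ M) (N : Set M) : Set M :=
  {x | x ∈ N ∧ ∀ t : ℝ, φ t x ∈ N}

/-- An isolating neighborhood: a compact set whose maximal invariant set lies in its interior. -/
def IsIsolatingNeighborhood (φ : Flow ℝ M) (N : Set M) : Prop :=
  IsCompact N ∧ maxInv φ N ⊆ interior N

/-- An isolated invariant set: `φ(t, S) = S` for all `t`, and `S` is the maximal invariant set of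
some isolating neighborhood. -/
def IsIsolatedInvariantSet (φ : Flow ℝ M) (S : Set M) : Prop :=
  (∀ t : ℝ, φ t '' S = S) ∧ ∃ N : Set M, IsIsolatingNeighborhood φ N ∧ S = maxInv φ N

/-- The Lyapunov property of `f` for `S` with respect to `N`: the derivative of `f` along the flow
is negative on `N \ S`. -/
def HasLyapunovProperty (φ : Flow ℝ M) (S N : Set M) (f : M → ℝ) : Prop :=
  ∀ x ∈ N \ S, deriv (fun t : ℝ => f (φ t x)) 0 < 0

end Flows

section Manifolds

variable {m : ℕ} {M : Type*} [TopologicalSpace M] [ChartedSpace (EuclideanSpace ℝ (Fin m)) M]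

/-- `h` is a local defining map of `D` near `p`, on the open set `U`: it is a smooth submersion
from `U` to `ℝ^c` and `D ∩ U` is its zero set in `U`. -/
structure IsLocalDefiningMap (c : ℕ) (D : Set M) (p : M) (U : Set M)
    (h : M → EuclideanSpace ℝ (Fin c)) : Prop where
  isOpen : IsOpen U
  mem : p ∈ U
  smooth : ContMDiffOn (𝓡 m) (𝓡 c) ∞ h U
  submersion : ∀ x ∈ U, Function.Surjective (mfderiv (𝓡 m) (𝓡 c) h x)
  eq_zero_iff : ∀ x ∈ U, x ∈ D ↔ h x = 0

/-- `D` is a smooth embedded submanifold of `M` (without boundary, not necessarily closed in `M`)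
of codimension `c`, that is, of dimension `m - c`. The empty set is allowed, and is the only
such set if `m < c`. -/
def IsSmoothSubmanifold (c : ℕ) (D : Set M) : Prop :=
  ∀ p ∈ D, ∃ U h, IsLocalDefiningMap (m := m) c D p U h

/-- The flow is transverse to the smooth hypersurface `D`: at each `p ∈ D` the generating vector
`X p` is not in `T_p D = ker dh_p`, where `h` is a local defining map of `D`. Here
`dh_p (X p)` is the derivative of `h` along the flow. -/
def IsTransverseTo (φ : Flow ℝ M) (D : Set M) : Prop :=
  ∀ p ∈ D, ∀ U h, IsLocalDefiningMap (m := m) 1 D p U h → deriv (fun t : ℝ => h (φ t p)) 0 ≠ 0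

/-- `B` is a compact submanifold of `M` of full dimension with piecewise smooth boundary: near a
boundary point there is a topological chart of `M` in which `B` is a half-space, and
the boundary is contained in a finite union of smooth hypersurfaces. -/
def IsCompactDomainWithPiecewiseSmoothBoundary (B : Set M) : Prop :=
  IsCompact B ∧
  (∀ p ∈ frontier B, ∃ (e : OpenPartialHomeomorph M (EuclideanSpace ℝ (Fin m))) (i : Fin m),
    p ∈ e.source ∧ e p i = 0 ∧ ∀ x ∈ e.source, x ∈ B ↔ 0 ≤ e x i) ∧
  ∃ (n : ℕ) (H : Fin n → Set M),
    (∀ j, IsSmoothSubmanifold (m := m) 1 (H j)) ∧ frontier B ⊆ ⋃ j, H j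

/-- A smooth isolating block. The sets `Bp`, `Bm`, `Bc` are `B₊`, `B₋`, `B_±` (entrance part,
exit part and corners of the boundary), and `Dp`, `Dm` are the hypersurfaces `D₊`, `D₋`. -/
def IsSmoothIsolatingBlock (φ : Flow ℝ M) (B : Set M) : Prop :=
  IsIsolatingNeighborhood φ B ∧
  IsCompactDomainWithPiecewiseSmoothBoundary (m := m) B ∧
  ∃ Bp Bm Bc Dp Dm : Set M,
    (frontier B = Bp ∪ Bm ∪ Bc ∧ Bp ∩ Bm = Bc ∧
      IsSmoothSubmanifold (m := m) 1 (Bm \ Bc) ∧ IsSmoothSubmanifold (m := m) 1 (Bp \ Bc)) ∧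
    (IsSmoothSubmanifold (m := m) 1 Dm ∧ IsSmoothSubmanifold (m := m) 1 Dp ∧
      Bp ⊆ Dp ∧ Bm ⊆ Dm ∧ Dm ∩ Dp = Bc ∧ IsSmoothSubmanifold (m := m) 2 Bc) ∧
    (IsTransverseTo (m := m) φ Dm ∧ IsTransverseTo (m := m) φ Dp ∧
      (∀ x ∈ Dm, ∃ ε > (0 : ℝ), ∀ t ∈ Ioo 0 ε, φ t x ∉ B) ∧
      (∀ x ∈ Dp, ∃ ε > (0 : ℝ), ∀ t ∈ Ioo (-ε) 0, φ t x ∉ B))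

/-- A smooth Lyapunov function for `(S, φ)`: a smooth function on `M` which is constant on `S` and
has the Lyapunov property with respect to some isolating neighborhood of `S`. -/
def IsSmoothLyapunovFunction (φ : Flow ℝ M) (S : Set M) (f : M → ℝ) : Prop :=
  ContMDiff (𝓡 m) 𝓘(ℝ, ℝ) ∞ f ∧
  (∃ a : ℝ, ∀ x ∈ S, f x = a) ∧
  ∃ N : Set M, IsIsolatingNeighborhood φ N ∧ maxInv φ N = S ∧ HasLyapunovProperty φ S N f

end Manifolds

end IsolatedDynamics

/-!
Let `x` be a point of the closed set `N` whose orbit leaves `N`, say at time `-T`, and let `h` be a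
bump function at `x` supported outside `φ T (N)`. The integral of `h` along the orbit segment of
length `T` has orbital derivative `h ∘ φ T - h`. The first term vanishes on `N`, so this derivative
is nonpositive on `N` and negative near `x`; on a complete orbit inside `N` both `h` and the
integral vanish. By second countability, countably many such functions suffice to have one of
negative orbital derivative at every point of `N` outside the maximal invariant set. Their sum is
the Lyapunov function, once they are weighted so that in each of countably many charts every
derivative of the series converges uniformly. The weights come from a diagonal argument: the `k`-th
one only has to control finitely many charts and orders of differentiation.
-/

namespace IsolatedDynamics

open Filter Function MeasureTheory Topology

section Series

theorem exists_pos_forall_eventually_mul_le {ι κ : Type*} [Countable ι] [Countable κ]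
    (C : ι → κ → ℝ) {u : κ → ℝ} (hu : ∀ k, 0 < u k) :
    ∃ ε : κ → ℝ, (∀ k, ε k ∈ Ioc 0 (u k)) ∧ ∀ i, ∀ᶠ k in cofinite, ε k * C i k ≤ u k := by
  obtain ⟨rankι, hrankι⟩ := exists_injective_nat ι
  obtain ⟨rankκ, hrankκ⟩ := exists_injective_nat κ
  have hfin (k : κ) : {i | rankι i ≤ rankκ k}.Finite :=
    (finite_le_nat _).preimage hrankι.injOn
  let A (k : κ) : ℝ := 1 + ∑ i ∈ (hfin k).toFinset, |C i k|
  have one_le_A (k : κ) : 1 ≤ A k := le_add_of_nonneg_right (by positivity)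
  have A_pos (k : κ) : 0 < A k := one_pos.trans_le (one_le_A k)
  refine ⟨fun k => u k / A k,
    fun k => ⟨div_pos (hu k) (A_pos k), div_le_self (hu k).le (one_le_A k)⟩, fun i => ?_⟩
  have hev : ∀ᶠ k in cofinite, rankι i ≤ rankκ k :=
    hrankκ.tendsto_cofinite.eventually (Nat.cofinite_eq_atTop ▸ eventually_ge_atTop (rankι i))
  filter_upwards [hev] with k hk
  have hCA : C i k ≤ A k := calc
    C i k ≤ |C i k| := le_abs_self _
    _ ≤ ∑ j ∈ (hfin k).toFinset, |C j k| :=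
      Finset.single_le_sum (f := fun j => |C j k|) (fun _ _ => abs_nonneg _)
        ((hfin k).mem_toFinset.2 hk)
    _ ≤ A k := le_add_of_nonneg_left zero_le_one
  calc u k / A k * C i k ≤ u k / A k * A k := by
        gcongr
        exact (div_pos (hu k) (A_pos k)).le
    _ = u k := div_mul_cancel₀ _ (A_pos k).ne'

variable {ι κ E V : Type*} [Countable ι] [Countable κ] [NormedAddCommGroup E] [NormedSpace ℝ E]
  [NormedAddCommGroup V] [NormedSpace ℝ V] [CompleteSpace V]

theorem exists_pos_forall_contDiff_tsum {G : ι → κ → E → V}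
    (hG : ∀ i k, ContDiff ℝ ∞ (G i k))
    (hbdd : ∀ i k (n : ℕ), ∃ C, ∀ y, ‖iteratedFDeriv ℝ n (G i k) y‖ ≤ C) :
    ∃ ε : κ → ℝ, (∀ k, 0 < ε k) ∧ Summable ε ∧ ∀ i,
      (∀ y, Summable fun k => ε k • G i k y) ∧ ContDiff ℝ ∞ fun y => ∑' k, ε k • G i k y := by
  choose C hC using hbdd
  have := Encodable.ofCountable κ
  obtain ⟨u, hu_pos, _, hu, -⟩ := posSumOfEncodable one_pos κ
  obtain ⟨ε, hε, hεC⟩ :=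
    exists_pos_forall_eventually_mul_le (fun (q : ι × ℕ) k => C q.1 k q.2) hu_pos
  have hderiv (i : ι) (n : ℕ) :
      ∀ᶠ k in cofinite, ∀ y, ‖iteratedFDeriv ℝ n (fun y => ε k • G i k y) y‖ ≤ u k := by
    filter_upwards [hεC (i, n)] with k hk y
    have hGn : ContDiffAt ℝ n (G i k) y := (hG i k).contDiffAt.of_le (mod_cast le_top)
    rw [show (fun y => ε k • G i k y) = ε k • G i k from rfl,
      iteratedFDeriv_const_smul_apply hGn, norm_smul, Real.norm_of_nonneg (hε k).1.le]
    exact (mul_le_mul_of_nonneg_left (hC i k n y) (hε k).1.le).trans hk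
  refine ⟨ε, fun k => (hε k).1, hu.summable.of_nonneg_of_le (fun k => (hε k).1.le)
    fun k => (hε k).2, fun i => ⟨fun y => ?_, ?_⟩⟩
  · refine .of_norm_bounded_eventually hu.summable ?_
    filter_upwards [hderiv i 0] with k hk
    simpa only [norm_iteratedFDeriv_zero] using hk y
  · exact contDiff_tsum_of_eventually (N := ⊤) (v := fun _ => u)
      (fun k => (hG i k).const_smul (ε k)) (fun _ _ => hu.summable) fun n _ => hderiv i n

end Series

section ParametricIntegral

variable {P V : Type*} [NormedAddCommGroup P] [NormedSpace ℝ P] [NormedAddCommGroup V]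
  [NormedSpace ℝ V] {n : ℕ∞} {s : Set P} {F : P × ℝ → V}

-- A cutoff equal to `1` on `Ioc a b` turns the integral into a convolution with the indicator of
-- `Ioc a b`, evaluated at `0`; the reflection in `g` is the one in the definition of convolution.
theorem contDiffOn_setIntegral_Ioc (hs : IsOpen s) (hF : ContDiffOn ℝ n F (s ×ˢ univ))
    (a b : ℝ) : ContDiffOn ℝ n (fun p => ∫ t in Ioc a b, F (p, t)) s := by
  obtain ⟨R, hR, hIoc⟩ := (isCompact_Icc (a := a) (b := b)).isBounded.subset_closedBall_lt 0 0
  let χ : ContDiffBump (0 : ℝ) := ⟨R, R + 1, hR, lt_add_one R⟩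
  let g (p : P) (t : ℝ) : V := χ t • F (p, -t)
  have hg : ContDiffOn ℝ n (uncurry g) (s ×ˢ univ) :=
    (χ.contDiff.comp contDiff_snd).contDiffOn.smul <|
      hF.comp (contDiff_fst.prodMk contDiff_snd.neg).contDiffOn fun q hq => ⟨hq.1, mem_univ _⟩
  have hg_zero (p : P) (t : ℝ) (_ : p ∈ s) (ht : t ∉ Metric.closedBall (0 : ℝ) (R + 1)) :
      g p t = 0 := by
    have hχ : χ t = 0 := χ.zero_of_le_dist (not_le.1 ht).le
    simp only [g, hχ, zero_smul]
  have hind : LocallyIntegrable ((Ioc a b).indicator fun _ => (1 : ℝ)) volume :=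
    (locallyIntegrable_const 1).indicator measurableSet_Ioc
  refine (contDiffOn_convolution_right_with_param_comp (ContinuousLinearMap.lsmul ℝ ℝ)
    (contDiffOn_const (c := (0 : ℝ))) hs (isCompact_closedBall _ _) hg_zero hind hg).congr
    fun p _ => ?_
  rw [convolution_def, ← integral_indicator measurableSet_Ioc]
  congr 1 with t
  by_cases ht : t ∈ Ioc a b
  · have hχ : χ (-t) = 1 := χ.one_of_mem_closedBall <| by
      simpa only [mem_closedBall_zero_iff, norm_neg] using hIoc (Ioc_subset_Icc_self ht)
    simp only [indicator_of_mem ht, g, zero_sub, neg_neg, hχ, one_smul,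
      ContinuousLinearMap.lsmul_apply]
  · simp only [indicator_of_notMem ht, map_zero, zero_apply]

theorem contDiffOn_intervalIntegral (hs : IsOpen s) (hF : ContDiffOn ℝ n F (s ×ˢ univ))
    (a b : ℝ) : ContDiffOn ℝ n (fun p => ∫ t in a..b, F (p, t)) s :=
  (contDiffOn_setIntegral_Ioc hs hF a b).sub (contDiffOn_setIntegral_Ioc hs hF b a)

end ParametricIntegral

section Charts

variable {E H M V : Type*} [NormedAddCommGroup E] [NormedSpace ℝ E] [TopologicalSpace H]
  {I : ModelWithCorners ℝ E H} [TopologicalSpace M] [ChartedSpace H M]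
  [NormedAddCommGroup V] [NormedSpace ℝ V] {n : ℕ∞}

theorem contMDiff_intervalIntegral [I.Boundaryless] [IsManifold I n M] {F : ℝ × M → V}
    (hF : ContMDiff (𝓘(ℝ, ℝ).prod I) 𝓘(ℝ, V) n F) (a b : ℝ) :
    ContMDiff I 𝓘(ℝ, V) n fun x => ∫ t in a..b, F (t, x) := by
  intro x
  let e := extChartAt I x
  have hopen : IsOpen e.target := isOpen_extChartAt_target x
  have hFe : ContDiffOn ℝ n (fun q : E × ℝ => F (q.2, e.symm q.1)) (e.target ×ˢ univ) := by
    have hpair : ContMDiffOn (𝓘(ℝ, E).prod 𝓘(ℝ, ℝ)) (𝓘(ℝ, ℝ).prod I) n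
        (fun q : E × ℝ => (q.2, e.symm q.1)) (e.target ×ˢ univ) :=
      contMDiff_snd.contMDiffOn.prodMk <|
        (contMDiffOn_extChartAt_symm x).comp contMDiff_fst.contMDiffOn fun q hq => hq.1
    have hcomp := hF.comp_contMDiffOn hpair
    rwa [← modelWithCornersSelf_prod, chartedSpaceSelf_prod, contMDiffOn_iff_contDiffOn] at hcomp
  have hint : ContDiffAt ℝ n (fun y => ∫ t in a..b, F (t, e.symm y)) (e x) :=
    (contDiffOn_intervalIntegral hopen hFe a b).contDiffAt (extChartAt_target_mem_nhds x)
  refine (hint.contMDiffAt.comp x contMDiffAt_extChartAt).congr_of_eventuallyEq ?_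
  filter_upwards [extChartAt_source_mem_nhds (I := I) x] with y hy
  simp only [e, comp_apply, (extChartAt I x).left_inv hy]

variable [FiniteDimensional ℝ E]

/-- The function `g` multiplied by the bump function `χ`, read in the chart at the center of `χ`
and extended by zero to the model space. This transports `g` to a compactly supported function on
`E` without changing it near the points where `χ` is locally `1`. -/
noncomputable def bumpRepresentative {c : M} (χ : SmoothBumpFunction I c) (g : M → V) (y : E) : V :=
  χ.toContDiffBump y • g ((extChartAt I c).symm y)

theorem hasCompactSupport_bumpRepresentative {c : M} (χ : SmoothBumpFunction I c) (g : M → V) :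
    HasCompactSupport (bumpRepresentative χ g) :=
  χ.toContDiffBump.hasCompactSupport.smul_right

theorem contDiff_bumpRepresentative [I.Boundaryless] [IsManifold I n M] {c : M}
    (χ : SmoothBumpFunction I c) {g : M → V} (hg : ContMDiff I 𝓘(ℝ, V) n g) :
    ContDiff ℝ n (bumpRepresentative χ g) := by
  have hχ : tsupport χ.toContDiffBump ⊆ (extChartAt I c).target := by
    simpa only [χ.tsupport_eq, I.range_eq_univ, inter_univ] using χ.closedBall_subset
  have hge : ContDiffOn ℝ n (fun y => g ((extChartAt I c).symm y)) (extChartAt I c).target :=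
    contMDiffOn_iff_contDiffOn.1 (hg.comp_contMDiffOn (contMDiffOn_extChartAt_symm c))
  rw [← contMDiff_iff_contDiff]
  refine contMDiff_of_tsupport fun y hy => ContDiffAt.contMDiffAt ?_
  have hy' : y ∈ (extChartAt I c).target := hχ (tsupport_smul_subset_left _ _ hy)
  exact χ.contDiffAt.smul (hge.contDiffAt ((isOpen_extChartAt_target c).mem_nhds hy'))

theorem eventually_bumpRepresentative_extChartAt_eq {c x : M} (χ : SmoothBumpFunction I c)
    (hx : x ∈ (chartAt H c).source) (hχ : χ =ᶠ[𝓝 x] 1) :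
    ∀ᶠ y in 𝓝 x, ∀ g : M → V, bumpRepresentative χ g (extChartAt I c y) = g y := by
  filter_upwards [hχ, χ.eventuallyEq_of_mem_source hx, (chartAt H c).open_source.mem_nhds hx]
    with y hy_one hy_eq hy g
  have hχy : χ.toContDiffBump (extChartAt I c y) = 1 := hy_eq.symm.trans hy_one
  rw [bumpRepresentative, hχy, one_smul, (extChartAt I c).left_inv (by rwa [extChartAt_source])]

theorem exists_pos_contMDiff_tsum [I.Boundaryless] [IsManifold I ∞ M] [T2Space M]
    [SigmaCompactSpace M] [CompleteSpace V] {κ : Type*} [Countable κ] {g : κ → M → V}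
    (hg : ∀ k, ContMDiff I 𝓘(ℝ, V) ∞ (g k)) :
    ∃ ε : κ → ℝ, (∀ k, 0 < ε k) ∧ Summable ε ∧ (∀ x, Summable fun k => ε k • g k x) ∧
      ContMDiff I 𝓘(ℝ, V) ∞ fun x => ∑' k, ε k • g k x := by
  obtain ⟨ι, χ, -⟩ := SmoothBumpCovering.exists_isSubordinate I (isClosed_univ (X := M))
    (U := fun _ => univ) fun _ _ => Filter.univ_mem
  have : Countable ι := countable_univ_iff.1 <|
    χ.locallyFinite.countable_univ fun i => (χ i).nonempty_support
  have hG (i : ι) (k : κ) : ContDiff ℝ ∞ (bumpRepresentative (χ i) (g k)) :=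
    contDiff_bumpRepresentative (χ i) (hg k)
  have hG_bdd (i : ι) (k : κ) (n : ℕ) :
      ∃ C, ∀ y, ‖iteratedFDeriv ℝ n (bumpRepresentative (χ i) (g k)) y‖ ≤ C :=
    ((hasCompactSupport_bumpRepresentative (χ i) (g k)).iteratedFDeriv n
      ).exists_bound_of_continuous ((hG i k).continuous_iteratedFDeriv (mod_cast le_top))
  obtain ⟨ε, hε, hε_sum, hsum⟩ := exists_pos_forall_contDiff_tsum hG hG_bdd
  have hlocal (x : M) : ∃ i, x ∈ (chartAt H (χ.c i)).source ∧
      ∀ᶠ y in 𝓝 x, ∀ k, bumpRepresentative (χ i) (g k) (extChartAt I (χ.c i) y) = g k y := by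
    have hsource := χ.mem_chartAt_ind_source x (mem_univ x)
    exact ⟨_, hsource, (eventually_bumpRepresentative_extChartAt_eq _ hsource
      (χ.eventuallyEq_one x (mem_univ x))).mono fun y hy k => hy (g k)⟩
  refine ⟨ε, hε, hε_sum, fun x => ?_, fun x => ?_⟩
  · obtain ⟨i, -, hi⟩ := hlocal x
    simpa only [hi.self_of_nhds] using (hsum i).1 (extChartAt I (χ.c i) x)
  · obtain ⟨i, hx, hi⟩ := hlocal x
    have hchart : ContMDiffAt I 𝓘(ℝ, E) ∞ (extChartAt I (χ.c i)) x := contMDiffAt_extChartAt' hx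
    refine ((hsum i).2.contMDiff.contMDiffAt.comp x hchart).congr_of_eventuallyEq ?_
    filter_upwards [hi] with y hy
    simp only [comp_apply, hy]

end Charts

section OrbitalDerivative

variable {M V : Type*} [TopologicalSpace M] [NormedAddCommGroup V] [NormedSpace ℝ V]
  {φ : Flow ℝ M}

/-- `f'` is the orbital derivative of `f`: its derivative along the generator of the flow `φ`. It
is enough to ask for it at time `0`, see `HasOrbitalDeriv.hasDerivAt`. -/
def HasOrbitalDeriv (φ : Flow ℝ M) (f f' : M → V) : Prop :=
  ∀ x, HasDerivAt (fun t => f (φ t x)) (f' x) 0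

theorem HasOrbitalDeriv.hasDerivAt {f f' : M → V} (hf : HasOrbitalDeriv φ f f') (x : M) (t : ℝ) :
    HasDerivAt (fun s => f (φ s x)) (f' (φ t x)) t := by
  have h := hf (φ t x)
  rw [← sub_self t] at h
  simpa only [← φ.map_add, sub_add_cancel] using h.comp_sub_const t t

theorem HasOrbitalDeriv.const_smul {f f' : M → V} (hf : HasOrbitalDeriv φ f f') (c : ℝ) :
    HasOrbitalDeriv φ (fun x => c • f x) fun x => c • f' x :=
  fun x => (hf x).const_smul c

theorem HasOrbitalDeriv.tsum [CompleteSpace V] {κ : Type*} {f f' : κ → M → V} {u : κ → ℝ}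
    (hu : Summable u) (hf : ∀ k, HasOrbitalDeriv φ (f k) (f' k))
    (hf' : ∀ k x, ‖f' k x‖ ≤ u k) (hsum : ∀ x, Summable fun k => f k x) :
    HasOrbitalDeriv φ (fun x => ∑' k, f k x) fun x => ∑' k, f' k x := by
  intro x
  simpa only [φ.map_zero_apply] using hasDerivAt_tsum hu (fun k t => (hf k).hasDerivAt x t)
    (fun k t => hf' k (φ t x)) (hsum (φ 0 x)) 0

/-- The integral of `h` along the orbit segment of length `T` starting at `x`. Its orbital
derivative telescopes to `h ∘ φ T - h`, which makes it a source of functions with a prescribed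
monotonicity along the flow. -/
noncomputable def flowIntegral (φ : Flow ℝ M) (T : ℝ) (h : M → V) (x : M) : V :=
  ∫ s in (0)..T, h (φ s x)

theorem hasOrbitalDeriv_flowIntegral [CompleteSpace V] {h : M → V} (hh : Continuous h) (T : ℝ) :
    HasOrbitalDeriv φ (flowIntegral φ T h) fun x => h (φ T x) - h x := by
  intro x
  have hc : Continuous fun s => h (φ s x) := by fun_prop
  have hshift : (fun t => flowIntegral φ T h (φ t x)) =
      fun t => (∫ s in (0)..(T + t), h (φ s x)) - ∫ s in (0)..t, h (φ s x) := by
    ext t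
    simp_rw [flowIntegral, ← φ.map_add]
    rw [intervalIntegral.integral_comp_add_right (fun s => h (φ s x)),
      intervalIntegral.integral_interval_sub_left (hc.intervalIntegrable _ _)
        (hc.intervalIntegrable _ _), zero_add]
  rw [hshift]
  simpa only [add_zero, φ.map_zero_apply] using
    ((hc.integral_hasStrictDerivAt 0 (T + 0)).hasDerivAt.comp_const_add T 0).fun_sub
      (hc.integral_hasStrictDerivAt 0 0).hasDerivAt

theorem contMDiff_flowIntegral {E H : Type*} [NormedAddCommGroup E] [NormedSpace ℝ E]
    [TopologicalSpace H] {I : ModelWithCorners ℝ E H} [I.Boundaryless] [ChartedSpace H M]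
    {n : ℕ∞} [IsManifold I n M]
    (hφ : ContMDiff (𝓘(ℝ, ℝ).prod I) I n fun q : ℝ × M => φ q.1 q.2) {h : M → V}
    (hh : ContMDiff I 𝓘(ℝ, V) n h) (T : ℝ) :
    ContMDiff I 𝓘(ℝ, V) n (flowIntegral φ T h) :=
  contMDiff_intervalIntegral (hh.comp hφ) 0 T

end OrbitalDerivative

section WeakLyapunov

variable {E H M : Type*} [NormedAddCommGroup E] [NormedSpace ℝ E] [TopologicalSpace H]
  {I : ModelWithCorners ℝ E H} [TopologicalSpace M] [ChartedSpace H M] {φ : Flow ℝ M}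
  {S N : Set M}

theorem isInvariant_maxInv (φ : Flow ℝ M) (N : Set M) : IsInvariant φ (maxInv φ N) :=
  fun t _ hx => ⟨hx.2 t, fun s => by rw [← φ.map_add]; exact hx.2 _⟩

variable (I) in
/-- `g` is a smooth weak Lyapunov function for `S` on `N` with orbital derivative `g'`: it
vanishes on `S` and does not increase along the flow in `N`. The bound on `g'` is a normalization
that makes series of such functions differentiable along the flow. -/
structure IsWeakLyapunovPair (φ : Flow ℝ M) (S N : Set M) (g g' : M → ℝ) : Prop where
  contMDiff : ContMDiff I 𝓘(ℝ, ℝ) ∞ g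
  hasOrbitalDeriv : HasOrbitalDeriv φ g g'
  continuous : Continuous g'
  abs_le_one : ∀ x, |g' x| ≤ 1
  eq_zero : ∀ x ∈ S, g x = 0
  nonpos : ∀ x ∈ N, g' x ≤ 0

theorem isWeakLyapunovPair_flowIntegral [I.Boundaryless] [IsManifold I ∞ M]
    (hφ : ContMDiff (𝓘(ℝ, ℝ).prod I) I ∞ fun q : ℝ × M => φ q.1 q.2) {h : M → ℝ}
    (hh : ContMDiff I 𝓘(ℝ, ℝ) ∞ h) (h_mem : ∀ x, h x ∈ Icc 0 1) {T : ℝ}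
    (hN : ∀ x ∈ N, h (φ T x) = 0) :
    IsWeakLyapunovPair I φ (maxInv φ N) N (flowIntegral φ T h) fun x => h (φ T x) - h x where
  contMDiff := contMDiff_flowIntegral hφ hh T
  hasOrbitalDeriv := hasOrbitalDeriv_flowIntegral hh.continuous T
  continuous := by
    have := hh.continuous
    fun_prop
  abs_le_one x := by
    simpa only [sub_zero] using abs_sub_le_of_le_of_le (h_mem (φ T x)).1 (h_mem (φ T x)).2
      (h_mem x).1 (h_mem x).2
  eq_zero x hx := by
    have hzero (s : ℝ) : h (φ s x) = 0 := by
      have := hN _ (isInvariant_maxInv φ N (s - T) hx).1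
      rwa [← φ.map_add, add_sub_cancel] at this
    simp only [flowIntegral, hzero, intervalIntegral.integral_zero]
  nonpos x hx := by simpa only [hN x hx, zero_sub, neg_nonpos] using (h_mem x).1

theorem exists_isWeakLyapunovPair_neg [I.Boundaryless] [FiniteDimensional ℝ E] [T2Space M]
    [IsManifold I ∞ M] (hφ : ContMDiff (𝓘(ℝ, ℝ).prod I) I ∞ fun q : ℝ × M => φ q.1 q.2)
    (hN : IsClosed N) {x : M} (hx : x ∈ N \ maxInv φ N) :
    ∃ g g' : M → ℝ, IsWeakLyapunovPair I φ (maxInv φ N) N g g' ∧ g' x < 0 := by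
  obtain ⟨T, hT⟩ : ∃ T, φ (-T) x ∉ N := by
    by_contra! hstay
    exact hx.2 ⟨hx.1, fun t => by simpa only [neg_neg] using hstay (-t)⟩
  have hU : φ (-T) ⁻¹' Nᶜ ∈ 𝓝 x :=
    (hN.isOpen_compl.preimage (φ.continuous_toFun (-T))).mem_nhds hT
  obtain ⟨h, -, h_supp⟩ := (SmoothBumpFunction.nhds_basis_tsupport (I := I) x).mem_iff.1 hU
  have hzero (y : M) (hy : y ∈ N) : h (φ T y) = 0 := by
    by_contra hne
    have : φ (-T) (φ T y) ∉ N := h_supp (subset_tsupport _ hne)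
    rw [← φ.map_add, neg_add_cancel, φ.map_zero_apply] at this
    exact this hy
  refine ⟨_, _, isWeakLyapunovPair_flowIntegral hφ h.contMDiff (fun _ => h.mem_Icc) hzero, ?_⟩
  simp only [hzero x hx.1, h.eq_one, zero_sub, neg_lt_zero, zero_lt_one]

theorem hasLyapunovProperty_tsum {κ : Type*} {g g' : κ → M → ℝ} {ε : κ → ℝ}
    (hg : ∀ k, IsWeakLyapunovPair I φ S N (g k) (g' k)) (hε : ∀ k, 0 < ε k)
    (hε_sum : Summable ε) (hsum : ∀ x, Summable fun k => ε k • g k x)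
    (hneg : ∀ x ∈ N \ S, ∃ k, g' k x < 0) :
    HasLyapunovProperty φ S N fun x => ∑' k, ε k • g k x := by
  have hbound (k : κ) (x : M) : ‖ε k • g' k x‖ ≤ ε k := by
    rw [norm_smul, Real.norm_of_nonneg (hε k).le]
    exact mul_le_of_le_one_right (hε k).le ((hg k).abs_le_one x)
  have hderiv : HasOrbitalDeriv φ (fun x => ∑' k, ε k • g k x) fun x => ∑' k, ε k • g' k x :=
    .tsum hε_sum (fun k => (hg k).hasOrbitalDeriv.const_smul (ε k)) hbound hsum
  intro x hx
  rw [(hderiv x).deriv]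
  obtain ⟨k, hk⟩ := hneg x hx
  calc ∑' k, ε k • g' k x < ∑' _ : κ, (0 : ℝ) :=
        (Summable.of_norm_bounded hε_sum fun k => hbound k x).tsum_lt_tsum
          (fun k => mul_nonpos_of_nonneg_of_nonpos (hε k).le ((hg k).nonpos x hx.1))
          (mul_neg_of_pos_of_neg (hε k) hk) summable_zero
    _ = 0 := tsum_zero

theorem exists_countable_isWeakLyapunovPair_neg [I.Boundaryless] [FiniteDimensional ℝ E]
    [T2Space M] [SecondCountableTopology M] [IsManifold I ∞ M]
    (hφ : ContMDiff (𝓘(ℝ, ℝ).prod I) I ∞ fun q : ℝ × M => φ q.1 q.2) (hN : IsClosed N) :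
    ∃ (c : Set M) (g g' : c → M → ℝ), c.Countable ∧
      (∀ k, IsWeakLyapunovPair I φ (maxInv φ N) N (g k) (g' k)) ∧
      ∀ x ∈ N \ maxInv φ N, ∃ k, g' k x < 0 := by
  choose! g g' hg hneg using
    fun x (hx : x ∈ N \ maxInv φ N) => exists_isWeakLyapunovPair_neg hφ hN hx
  have hnhds (x : M) (hx : x ∈ N \ maxInv φ N) : {y | g' x y < 0} ∈ 𝓝[N \ maxInv φ N] x :=
    mem_nhdsWithin_of_mem_nhds <|
      (isOpen_lt (hg x hx).continuous continuous_const).mem_nhds (hneg x hx)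
  obtain ⟨c, hcN, hc, hcover⟩ := TopologicalSpace.countable_cover_nhdsWithin hnhds
  refine ⟨c, fun k => g k, fun k => g' k, hc, fun k => hg k (hcN k.2), fun x hx => ?_⟩
  obtain ⟨k, hkc, hk⟩ := mem_iUnion₂.1 (hcover hx)
  exact ⟨⟨k, hkc⟩, hk⟩

end WeakLyapunov

end IsolatedDynamics

open IsolatedDynamics in
theorem mainTheorem10_general {E H M : Type*} [NormedAddCommGroup E] [NormedSpace ℝ E]
    [FiniteDimensional ℝ E] [TopologicalSpace H] {I : ModelWithCorners ℝ E H} [I.Boundaryless]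
    [TopologicalSpace M] [T2Space M] [SecondCountableTopology M] [ChartedSpace H M]
    [IsManifold I ∞ M] {φ : Flow ℝ M}
    (hφ : ContMDiff (𝓘(ℝ, ℝ).prod I) I ∞ fun q : ℝ × M => φ q.1 q.2) {N : Set M}
    (hN : IsClosed N) :
    ∃ f : M → ℝ, ContMDiff I 𝓘(ℝ, ℝ) ∞ f ∧ (∀ x ∈ maxInv φ N, f x = 0) ∧
      HasLyapunovProperty φ (maxInv φ N) N f := by
  have : LocallyCompactSpace M := Manifold.locallyCompact_of_finiteDimensional I
  obtain ⟨c, g, g', hc, hg, hneg⟩ := exists_countable_isWeakLyapunovPair_neg hφ hN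
  have : Countable c := hc.to_subtype
  obtain ⟨ε, hε, hε_sum, hsum, hsmooth⟩ := exists_pos_contMDiff_tsum fun k => (hg k).contMDiff
  refine ⟨_, hsmooth, fun x hx => ?_, hasLyapunovProperty_tsum hg hε hε_sum hsum hneg⟩
  simp only [(hg _).eq_zero x hx, smul_zero, tsum_zero]

theorem mainTheorem10 {m : ℕ} {M : Type*} [TopologicalSpace M] [T2Space M]
    [SecondCountableTopology M] [ChartedSpace (EuclideanSpace ℝ (Fin m)) M]
    [IsManifold (𝓡 m) ∞ M]
    (φ : Flow ℝ M)
    (hφ : ContMDiff (𝓘(ℝ, ℝ).prod (𝓡 m)) (𝓡 m) ∞ (fun q : ℝ × M => φ q.1 q.2))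
    (S B : Set M)
    (hS : IsolatedDynamics.IsIsolatedInvariantSet φ S)
    (hB : IsolatedDynamics.IsSmoothIsolatingBlock (m := m) φ B)
    (hBS : IsolatedDynamics.maxInv φ B = S) :
    ∃ f : M → ℝ, IsolatedDynamics.IsSmoothLyapunovFunction (m := m) φ S f ∧
      IsolatedDynamics.HasLyapunovProperty φ S B f := by
  subst hBS
  obtain ⟨f, hf, hf_zero, hf_neg⟩ := mainTheorem10_general hφ hB.1.1.isClosed
  exact ⟨f, ⟨hf, ⟨0, hf_zero⟩, B, hB.1, rfl, hf_neg⟩, hf_neg⟩
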